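/- Let $n \ge 3$ and let $X$ be a set with $n$ elements. For binary relations $\alpha,\beta$ on $X$ and $x,y\in X$ write $x\alpha=\{z\in X : (x,z)\in\alpha\}$ and $\beta y=\{z\in X : (z,y)\in\beta\}$, and put $$\alpha\diamond\beta=\{(x,y)\in X\times X : x\alpha=\beta y\neq\emptyset\}.$$ Let $\mathcal D_n$ be the set of all difunctional relations on $X$, that is, of all relations $\alpha$ on $X$ with $\alpha=\alpha\circ\alpha^{-1}\circ\alpha$; it is a semigroup under $\diamond$. Then $$\operatorname{rank}(\mathcal D_n,\diamond)=B(n)+n,$$ where the rank of a semigroup is the least cardinality of a subset that generates it as a semigroup, and $B(n)$ is the $n$th Bell number, the number of partitions of an $n$-element set. -/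

import Mathlib

open scoped SetRel

/-- A relation `α` on `X` is difunctional if `α = α ∘ α⁻¹ ∘ α`. -/
def IsDifunctional {X : Type*} (α : SetRel X X) : Prop :=
  α = (α ○ α.inv) ○ α

theorem isDifunctional_iff {X : Type*} (α : SetRel X X) :
    IsDifunctional α ↔
      ∀ x y x' y', (x, y) ∈ α → (x', y) ∈ α → (x', y') ∈ α → (x, y') ∈ α := by
  constructor
  · intro h x y x' y' h1 h2 h3
    rw [h]
    exact ⟨x', ⟨y, h1, h2⟩, h3⟩
  · intro h
    apply Set.Subset.antisymm
    · rintro ⟨x, y⟩ hxy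
      exact ⟨x, ⟨y, hxy, hxy⟩, hxy⟩
    · rintro ⟨x, y'⟩ ⟨x', ⟨y, h1, h2⟩, h3⟩
      exact h x y x' y' h1 h2 h3

/-- The operation `α ⋄ β = {(x, y) | xα = βy ≠ ∅}` on relations, where
`xα = {z | (x, z) ∈ α}` and `βy = {z | (z, y) ∈ β}`. -/
def diamond {X : Type*} (α β : SetRel X X) : SetRel X X :=
  {p | {z | (p.1, z) ∈ α} = {z | (z, p.2) ∈ β} ∧ {z | (z, p.2) ∈ β} ≠ ∅}

theorem mem_diamond {X : Type*} (α β : SetRel X X) (x y : X) :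
    (x, y) ∈ diamond α β ↔
      (∀ z, (x, z) ∈ α ↔ (z, y) ∈ β) ∧ ∃ z, (z, y) ∈ β := by
  simp only [diamond, Set.mem_ofPred_eq, Set.ext_iff, ← Set.nonempty_iff_ne_empty]
  rfl

theorem isDifunctional_diamond {X : Type*} (α β : SetRel X X) :
    IsDifunctional (diamond α β) := by
  rw [isDifunctional_iff]
  intro x y x' y' h1 h2 h3
  rw [mem_diamond] at *
  exact ⟨fun z => (h1.1 z).trans ((h2.1 z).symm.trans (h3.1 z)), h3.2⟩

theorem diamond_assoc {X : Type*} (α β γ : SetRel X X) (hβ : IsDifunctional β) :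
    diamond (diamond α β) γ = diamond α (diamond β γ) := by
  rw [isDifunctional_iff] at hβ
  ext ⟨x, y⟩
  rw [mem_diamond, mem_diamond]
  simp only [mem_diamond]
  constructor
  · rintro ⟨h, z, hz⟩
    obtain ⟨hxz, w, hw⟩ := (h z).2 hz
    have key : ∀ v, (x, v) ∈ α →
        (∀ u, (v, u) ∈ β ↔ (u, y) ∈ γ) ∧ ∃ u, (u, y) ∈ γ := by
      intro v hv
      have hvz := (hxz v).1 hv
      refine ⟨fun u => ⟨fun hvu => ?_, fun hu => (((h u).2 hu).1 v).1 hv⟩, z, hz⟩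
      refine (h u).1 ⟨fun t => (hxz t).trans ⟨fun ht => ?_, fun ht => ?_⟩, v, hvu⟩
      · exact hβ t z v u ht hvz hvu
      · exact hβ t u v z ht hvu hvz
    exact ⟨fun v => ⟨key v, fun hv => (hxz v).2 ((hv.1 z).2 hz)⟩,
      w, key w ((hxz w).2 hw)⟩
  · rintro ⟨h, w, hw⟩
    obtain ⟨hwy, z, hz⟩ := hw
    have hxw := (h w).2 ⟨hwy, z, hz⟩
    refine ⟨fun u => ⟨fun hu => ?_, fun hu => ?_⟩, z, hz⟩
    · exact (hwy u).1 ((hu.1 w).1 hxw)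
    · refine ⟨fun v => ⟨fun hv => (((h v).1 hv).1 u).2 hu, fun hv => ?_⟩,
        w, (hwy u).2 hu⟩
      refine (h v).2 ⟨fun t => ⟨fun ht => ?_, fun ht => ?_⟩, z, hz⟩
      · exact (hwy t).1 (hβ w u v t ((hwy u).2 hu) hv ht)
      · exact hβ v u w t hv ((hwy u).2 hu) ((hwy t).2 ht)

/-- The set of all difunctional relations on `X`. -/
abbrev Difunctional (X : Type*) : Type _ := {α : SetRel X X // IsDifunctional α}

/-- The difunctional relations on `X` form a semigroup under `⋄`. -/
instance Difunctional.instSemigroup (X : Type*) : Semigroup (Difunctional X) where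
  mul α β := ⟨diamond α.1 β.1, isDifunctional_diamond α.1 β.1⟩
  mul_assoc α β γ := Subtype.ext (diamond_assoc α.1 β.1 γ.1 β.2)

theorem Difunctional.coe_mul {X : Type*} (α β : Difunctional X) :
    (α * β).1 = diamond α.1 β.1 := rfl

/-! A difunctional relation matches the blocks of a partition of its domain with those of a
partition of its codomain, and `⋄` links two blocks only where a codomain block of the first factor
is exactly a domain block of the second. Write S(n,k) for the number of partitions into k classes;
these sum to B(n) over 1 ≤ k ≤ n, so it suffices to see that each k costs S(n,k) + 1 generators.

Lower bound: the first factor of a left total product is left total with the same domain partition,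
so each partition into k classes is the domain partition of a left total generator, and dually the
codomain partition of a right total one. With only S(n,k) generators at level k, the left total and
the right total ones coincide. Then every left total element with k classes is right total, which is
false for k < n; for k = n a single generator would make the symmetric group commutative
(`countClasses_lt_ncard_level`).

Upper bound: two permutations generate rank n. For 1 ≤ k < n a closed path through all partitions
into k classes, based at a labelling that misses some point, has S(n,k) + 1 edges. These edges and
the relations of rank k + 1 (permutations when k = n - 1) yield rank k (`exists_generators`). -/

/-! ### Bell numbers count equivalence relations. -/

/-- Setoids on `Option Y` whose class of `none` is the complement of `S` correspond to
setoids on `S`. -/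
noncomputable def setoidOptionFiberEquiv {Y : Type*} (S : Set Y) :
    {r : Setoid (Option Y) // {y | ¬ r none (some y)} = S} ≃ Setoid S := by
  classical
  exact
  { toFun := fun r => r.1.comap (fun y => some y.1)
    invFun := fun s => ⟨Setoid.ker (fun a : Option Y =>
        a.bind fun y => if h : y ∈ S then some (Quotient.mk s ⟨y, h⟩) else none), by
      ext y
      by_cases h : y ∈ S <;> simp [Setoid.ker_def, h]⟩
    left_inv := by
      rintro ⟨r, rfl⟩
      apply Subtype.ext
      ext a b
      rcases a with _ | a <;> rcases b with _ | b
      · simp 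
      · by_cases hb : r none (some b) <;> simp [Setoid.ker_def, hb]
      · by_cases hb : r none (some a)
        · simp [Setoid.ker_def, hb, r.symm' hb]
        · have : ¬ r (some a) none := fun h => hb (r.symm' h)
          simp [Setoid.ker_def, hb, this]
      · by_cases ha : r none (some a) <;> by_cases hb : r none (some b)
        · simp [Setoid.ker_def, ha, hb, r.trans' (r.symm' ha) hb]
        · have : ¬ r (some a) (some b) := fun h => hb (r.trans' ha h)
          simp [Setoid.ker_def, ha, hb, this]
        · have : ¬ r (some a) (some b) := fun h => ha (r.trans' hb (r.symm' h))
          simp [Setoid.ker_def, ha, hb, this]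
        · simp [Setoid.ker_def, ha, hb, Quotient.eq, Setoid.comap_rel]
    right_inv := by
      intro s
      ext ⟨a, ha⟩ ⟨b, hb⟩
      simp [Setoid.ker_def, ha, hb, Quotient.eq] }

instance Setoid.instFinite {Y : Type*} [Finite Y] : Finite (Setoid Y) :=
  Finite.of_injective (fun s : Setoid Y => (fun a b => s a b : Y → Y → Prop))
    fun _ _ h => Setoid.ext fun a b => iff_of_eq (congrFun (congrFun h a) b)

theorem Setoid.natCard_congr {X Y : Type*} (e : X ≃ Y) :
    Nat.card (Setoid X) = Nat.card (Setoid Y) :=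
  Nat.card_congr
    { toFun := fun s => s.comap e.symm
      invFun := fun s => s.comap e
      left_inv := fun s => by ext; simp [Setoid.comap_rel]
      right_inv := fun s => by ext; simp [Setoid.comap_rel] }

/-- Sorting by the set of points outside the class of `none` gives the Bell recurrence. -/
theorem Setoid.natCard_fin_eq_bell (n : ℕ) : Nat.card (Setoid (Fin n)) = Nat.bell n := by
  classical
  induction n using Nat.strong_induction_on with
  | _ n ih =>
  rcases n with _ | n
  · have : Subsingleton (Setoid (Fin 0)) := ⟨fun a b => Setoid.ext fun x => isEmptyElim x⟩
    rw [Nat.bell_zero]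
    exact Nat.card_unique
  · rw [Setoid.natCard_congr (finSuccEquiv n), Nat.bell_succ',
      ← Nat.card_congr (Equiv.sigmaFiberEquiv
        fun r : Setoid (Option (Fin n)) => {y | ¬ r none (some y)}), Nat.card_sigma]
    have h : ∀ S : Finset (Fin n),
        Nat.card {r : Setoid (Option (Fin n)) // {y | ¬ r none (some y)} = (S : Set (Fin n))} =
          Nat.bell S.card := by
      intro S
      have hS : S.card < n + 1 := Nat.lt_succ_of_le (by simpa using Finset.card_le_univ S)
      rw [Nat.card_congr (setoidOptionFiberEquiv (S : Set (Fin n))), ← ih _ hS]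
      exact Setoid.natCard_congr S.equivFin
    rw [← Equiv.sum_comp (Fintype.finsetEquivSet (α := Fin n))]
    simp only [Fintype.finsetEquivSet_apply, h]
    rw [← Finset.powerset_univ, Finset.sum_powerset_apply_card, Finset.card_univ, Fintype.card_fin,
      ← Finset.Nat.sum_antidiagonal_swap, Finset.Nat.sum_antidiagonal_eq_sum_range_succ_mk]
    refine Finset.sum_congr rfl fun k hk => ?_
    have hk : k ≤ n := Nat.lt_succ_iff.1 (Finset.mem_range.1 hk)
    simp [Nat.choose_symm hk]

/-- The Bell number `Nat.bell n` counts the equivalence relations on a set with `n` elements. -/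
theorem Setoid.natCard_eq_bell {X : Type*} [Finite X] :
    Nat.card (Setoid X) = Nat.bell (Nat.card X) := by
  rw [Setoid.natCard_congr (Finite.equivFin X), Setoid.natCard_fin_eq_bell]

/-! ### Domain and codomain partitions of products. -/

namespace Difunctional

variable {X : Type*}

theorem trans_mem (α : Difunctional X) {x y x' y' : X} (h₁ : (x, y) ∈ α.1) (h₂ : (x', y) ∈ α.1)
    (h₃ : (x', y') ∈ α.1) : (x, y') ∈ α.1 :=
  (isDifunctional_iff α.1).1 α.2 x y x' y' h₁ h₂ h₃

theorem mem_mul {α β : Difunctional X} {x y : X} :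
    (x, y) ∈ (α * β).1 ↔ (∀ z, (x, z) ∈ α.1 ↔ (z, y) ∈ β.1) ∧ ∃ z, (z, y) ∈ β.1 :=
  mem_diamond α.1 β.1 x y

theorem ext_mem {α β : Difunctional X} (h : ∀ x y, (x, y) ∈ α.1 ↔ (x, y) ∈ β.1) : α = β :=
  Subtype.ext (Set.ext fun p => h p.1 p.2)

/-- The difunctional relation whose blocks are the products of the fibres of `f` and `g` over
the same label. -/
def ofLabels {ι : Type*} (f g : X → Option ι) : Difunctional X :=
  ⟨{p | f p.1 = g p.2 ∧ f p.1 ≠ none}, by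
    rw [isDifunctional_iff]
    rintro x y x' y' ⟨h₁, h₁'⟩ ⟨h₂, -⟩ ⟨h₃, -⟩
    exact ⟨h₁.trans (h₂.symm.trans h₃), h₁'⟩⟩

theorem mem_ofLabels {ι : Type*} {f g : X → Option ι} {x y : X} :
    (x, y) ∈ (ofLabels f g).1 ↔ f x = g y ∧ f x ≠ none := Iff.rfl

/-- The inverse of a difunctional relation. -/
def inverse (α : Difunctional X) : Difunctional X :=
  ⟨α.1.inv, by
    rw [isDifunctional_iff]
    intro x y x' y' h₁ h₂ h₃
    exact α.trans_mem h₃ h₂ h₁⟩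

theorem mem_inverse {α : Difunctional X} {x y : X} :
    (x, y) ∈ (inverse α).1 ↔ (y, x) ∈ α.1 := Iff.rfl

theorem inverse_mul (α β : Difunctional X) : inverse (α * β) = inverse β * inverse α := by
  refine ext_mem fun x y => ?_
  simp only [mem_inverse, mem_mul]
  constructor
  · rintro ⟨h, z, hz⟩
    exact ⟨fun z => (h z).symm, z, (h z).2 hz⟩
  · rintro ⟨h, z, hz⟩
    exact ⟨fun z => (h z).symm, z, (h z).2 hz⟩

theorem inverse_ofLabels {ι : Type*} (f g : X → Option ι) :
    inverse (ofLabels f g) = ofLabels g f := by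
  refine ext_mem fun x y => ?_
  simp only [mem_inverse, mem_ofLabels]
  constructor
  · rintro ⟨h, h'⟩
    exact ⟨h.symm, h ▸ h'⟩
  · rintro ⟨h, h'⟩
    exact ⟨h.symm, h ▸ h'⟩

/-- Every element of `X` lies in the domain of `α`. -/
def LeftTotal (α : Difunctional X) : Prop := ∀ x, ∃ y, (x, y) ∈ α.1

/-- The equivalence relation relating the elements with the same image under `α`. -/
def domSetoid (α : Difunctional X) : Setoid X where
  r x x' := ∀ z, (x, z) ∈ α.1 ↔ (x', z) ∈ α.1
  iseqv := ⟨fun _ _ => Iff.rfl, fun h z => (h z).symm, fun h h' z => (h z).trans (h' z)⟩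

theorem domSetoid_rel {α : Difunctional X} {x x' : X} :
    domSetoid α x x' ↔ ∀ z, (x, z) ∈ α.1 ↔ (x', z) ∈ α.1 := Iff.rfl

theorem domSetoid_rel_of_mem {α : Difunctional X} {x x' y : X} (h : (x, y) ∈ α.1)
    (h' : (x', y) ∈ α.1) : domSetoid α x x' :=
  fun _ => ⟨fun hz => α.trans_mem h' h hz, fun hz => α.trans_mem h h' hz⟩

/-- The number of classes of `domSetoid α`. -/
noncomputable def numClasses (α : Difunctional X) : ℕ := Nat.card (Quotient (domSetoid α))

theorem LeftTotal.of_mul {α β : Difunctional X} (h : LeftTotal (α * β)) : LeftTotal α := by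
  intro x
  obtain ⟨y, hy⟩ := h x
  obtain ⟨hy, z, hz⟩ := mem_mul.1 hy
  exact ⟨z, (hy z).2 hz⟩

/-- Any y in the row of x under the product recovers the row of x under `α`, as the column βy. -/
theorem domSetoid_mul {α β : Difunctional X} (h : LeftTotal (α * β)) :
    domSetoid (α * β) = domSetoid α := by
  ext x x'
  constructor
  · intro hx z
    obtain ⟨y, hy⟩ := h x
    exact ((mem_mul.1 hy).1 z).trans ((mem_mul.1 ((hx y).1 hy)).1 z).symm
  · intro hx z
    simp only [mem_mul, domSetoid_rel.1 hx]

theorem LeftTotal.right_of_mul {α β : Difunctional X} (h : LeftTotal (α * β))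
    (hα : LeftTotal (inverse α)) : LeftTotal β := by
  intro z
  obtain ⟨x, hx⟩ := hα z
  obtain ⟨y, hy⟩ := h x
  exact ⟨y, ((mem_mul.1 hy).1 z).1 hx⟩

/-- Every row of `α` is a column of `β`, and the rows of `α` cover X. -/
theorem domSetoid_inverse_eq {α β : Difunctional X} (h : LeftTotal (α * β))
    (hα : LeftTotal (inverse α)) : domSetoid (inverse α) = domSetoid β := by
  ext z z'
  obtain ⟨x, hx⟩ := hα z
  obtain ⟨y, hy⟩ := h x
  have hy := (mem_mul.1 hy).1
  constructor
  · intro hz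
    exact domSetoid_rel_of_mem ((hy z).1 hx) ((hy z').1 ((hz x).1 hx))
  · intro hz
    exact domSetoid_rel_of_mem hx ((hy z').2 ((hz y).1 ((hy z).1 hx)))

theorem LeftTotal.inverse_mul {α β : Difunctional X} (h : LeftTotal (α * β))
    (hα : LeftTotal (inverse α)) (hβ : LeftTotal (inverse β)) :
    LeftTotal (inverse (α * β)) := by
  intro w
  obtain ⟨z, hz⟩ := hβ w
  obtain ⟨x, hx⟩ := hα z
  obtain ⟨y, hy⟩ := h x
  have hy := (mem_mul.1 hy).1
  have hzy := (hy z).1 hx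
  refine ⟨x, mem_mul.2 ⟨fun u => (hy u).trans ?_, z, hz⟩⟩
  exact ⟨fun hu => β.trans_mem hu hzy hz, fun hu => β.trans_mem hu hz hzy⟩

theorem numClasses_le_inverse [Finite X] {α : Difunctional X} (h : LeftTotal α) :
    numClasses α ≤ numClasses (inverse α) := by
  choose y hy using h
  refine Nat.card_le_card_of_injective
    (fun q : Quotient (domSetoid α) => (Quotient.mk (domSetoid (inverse α)) (y q.out))) ?_
  intro q q' hq
  have hq : domSetoid (inverse α) (y q.out) (y q'.out) := Quotient.exact hq
  rw [← q.out_eq, ← q'.out_eq]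
  exact Quotient.sound
    (domSetoid_rel_of_mem (hy _) ((hq q'.out).2 (hy _)))

theorem numClasses_inverse [Finite X] {α : Difunctional X} (h : LeftTotal α)
    (h' : LeftTotal (inverse α)) : numClasses (inverse α) = numClasses α :=
  le_antisymm (numClasses_le_inverse h') (numClasses_le_inverse h)

/-- A setoid with at least as many classes as elements is trivial. -/
theorem _root_.Setoid.eq_bot_of_card_quotient [Finite X] {s : Setoid X}
    (h : Nat.card (Quotient s) = Nat.card X) : s = ⊥ := by
  have := (Function.Surjective.bijective_of_nat_card_le
    (Quotient.mk_surjective (s := s)) h.ge).1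
  ext x y
  exact ⟨fun hxy => this (Quotient.sound hxy), fun hxy => by rw [show x = y from hxy]⟩

theorem leftTotal_ofLabels {ι : Type*} {f g : X → Option ι} (hf : ∀ x, f x ≠ none)
    (hg : ∀ i, ∃ y, g y = some i) : LeftTotal (ofLabels f g) := by
  intro x
  obtain ⟨i, hi⟩ := Option.ne_none_iff_exists'.1 (hf x)
  obtain ⟨y, hy⟩ := hg i
  exact ⟨y, hi.trans hy.symm, hf x⟩

theorem domSetoid_ofLabels {ι : Type*} {f g : X → Option ι} (hf : ∀ x, f x ≠ none)
    (hg : ∀ i, ∃ y, g y = some i) : domSetoid (ofLabels f g) = Setoid.ker f := by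
  ext x x'
  rw [Setoid.ker_def]
  constructor
  · intro h
    obtain ⟨y, hy⟩ := leftTotal_ofLabels hf hg x
    exact hy.1.trans ((h y).1 hy).1.symm
  · intro h z
    simp only [mem_ofLabels, h]

variable {A : Set (Difunctional X)}

/-- The first factor of a left total product keeps its domain partition; apply this to the
equivalence relation `s` itself, viewed as an element. -/
theorem exists_generator_domSetoid_eq (hA : Subsemigroup.closure A = ⊤) (s : Setoid X) :
    ∃ α ∈ A, LeftTotal α ∧ domSetoid α = s := by
  have key : ∀ γ ∈ Subsemigroup.closure A, LeftTotal γ →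
      ∃ α ∈ A, LeftTotal α ∧ domSetoid α = domSetoid γ := by
    intro γ hγ
    induction hγ using Subsemigroup.closure_induction with
    | mem γ h => exact fun hγ => ⟨γ, h, hγ, rfl⟩
    | mul α β _ _ hα _ =>
      intro h
      rw [domSetoid_mul h]
      exact hα h.of_mul
  let f : X → Option (Quotient s) := fun x => some (Quotient.mk s x)
  have hf : ∀ x, f x ≠ none := by simp [f]
  have hf' : ∀ i, ∃ y, f y = some i := fun i => ⟨i.out, by simp [f]⟩
  obtain ⟨α, h, h', h''⟩ := key (ofLabels f f) (hA ▸ Subsemigroup.mem_top _)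
    (leftTotal_ofLabels hf hf')
  refine ⟨α, h, h', h''.trans ?_⟩
  rw [domSetoid_ofLabels hf hf']
  ext x y
  simp [f, Setoid.ker_def, Quotient.eq]

theorem exists_generator_domSetoid_inverse_eq (hA : Subsemigroup.closure A = ⊤) (s : Setoid X) :
    ∃ α ∈ A, LeftTotal (inverse α) ∧ domSetoid (inverse α) = s := by
  have hA' : Subsemigroup.closure (inverse '' A) = ⊤ := by
    rw [eq_top_iff]
    rintro γ -
    have : ∀ γ ∈ Subsemigroup.closure A, inverse γ ∈ Subsemigroup.closure (inverse '' A) := by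
      intro γ hγ
      induction hγ using Subsemigroup.closure_induction with
      | mem γ h => exact Subsemigroup.subset_closure ⟨γ, h, rfl⟩
      | mul α β _ _ hα hβ =>
        rw [Difunctional.inverse_mul]
        exact mul_mem hβ hα
    exact this (inverse γ) (hA ▸ Subsemigroup.mem_top _)
  obtain ⟨_, ⟨α, hα, rfl⟩, h⟩ := exists_generator_domSetoid_eq hA' s
  exact ⟨α, hα, h⟩

/-- If all the left total elements of `A` with `k` classes are right total, then the left total
elements with `k` classes generated by `A` are products of such elements of `A`. -/
theorem mem_closure_of_leftTotal [Finite X] {k : ℕ}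
    (h : ∀ α ∈ A, LeftTotal α → numClasses α = k → LeftTotal (inverse α)) :
    ∀ γ ∈ Subsemigroup.closure A, LeftTotal γ → numClasses γ = k →
      LeftTotal (inverse γ) ∧ γ ∈ Subsemigroup.closure {α ∈ A | LeftTotal α ∧ numClasses α = k} := by
  intro γ hγ
  induction hγ using Subsemigroup.closure_induction with
  | mem γ hγ => exact fun h₁ h₂ => ⟨h γ hγ h₁ h₂, Subsemigroup.subset_closure ⟨hγ, h₁, h₂⟩⟩
  | mul α β _ _ hα hβ =>
    intro h₁ h₂
    rw [numClasses, domSetoid_mul h₁] at h₂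
    obtain ⟨hα₁, hα₂⟩ := hα h₁.of_mul h₂
    -- The codomain partition of `α`, again with `k` classes, is the domain partition of `β`.
    have hk : numClasses β = k := by
      rw [numClasses, ← domSetoid_inverse_eq h₁ hα₁]
      exact (numClasses_inverse h₁.of_mul hα₁).trans h₂
    obtain ⟨hβ₁, hβ₂⟩ := hβ (h₁.right_of_mul hα₁) hk
    exact ⟨h₁.inverse_mul hα₁ hβ₁, mul_mem hα₂ hβ₂⟩

end Difunctional

/-! ### Permutations, levels and the lower bound. -/

namespace Difunctional

variable {X : Type*}

/-- The graph of a permutation. -/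
def graph (π : Equiv.Perm X) : Difunctional X := ofLabels (fun x => some (π x)) some

theorem mem_graph {π : Equiv.Perm X} {x y : X} : (x, y) ∈ (graph π).1 ↔ π x = y := by
  simp [graph, mem_ofLabels]

theorem graph_injective : Function.Injective (graph (X := X)) := by
  intro π τ h
  ext x
  exact (mem_graph.1 (h ▸ mem_graph.2 rfl : (x, π x) ∈ (graph τ).1)).symm

theorem graph_mul_graph (π τ : Equiv.Perm X) : graph π * graph τ = graph (τ * π) := by
  refine ext_mem fun x y => ?_
  simp only [mem_mul, mem_graph, Equiv.Perm.mul_apply]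
  constructor
  · rintro ⟨h, -⟩
    exact (h _).1 rfl
  · rintro rfl
    exact ⟨fun z => by simp [eq_comm], π x, rfl⟩

theorem leftTotal_graph (π : Equiv.Perm X) : LeftTotal (graph π) :=
  fun x => ⟨π x, mem_graph.2 rfl⟩

theorem numClasses_graph (π : Equiv.Perm X) : numClasses (graph π) = Nat.card X := by
  rw [numClasses, graph, domSetoid_ofLabels (by simp) (fun i => ⟨i, rfl⟩)]
  refine (Nat.card_congr (Equiv.ofBijective
    (Quotient.mk (Setoid.ker fun x => some (π x))) ⟨?_, Quotient.mk_surjective⟩)).symm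
  intro x y h
  have := Quotient.exact h
  simpa [Setoid.ker_def] using (Setoid.ker_def.1 this)

open Classical in
/-- The number of classes of `domSetoid α` if `α` is left total, of `domSetoid (inverse α)` if `α`
is only right total, and `0` otherwise. -/
noncomputable def level (α : Difunctional X) : ℕ :=
  if LeftTotal α then numClasses α
  else if LeftTotal (inverse α) then numClasses (inverse α) else 0

end Difunctional

/-- The number of equivalence relations with `k` classes. -/
noncomputable def Setoid.countClasses (X : Type*) (k : ℕ) : ℕ :=
  {s : Setoid X | Nat.card (Quotient s) = k}.ncard

theorem Setoid.countClasses_card_le_one (X : Type*) [Finite X] :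
    Setoid.countClasses X (Nat.card X) ≤ 1 :=
  (Set.ncard_le_ncard (t := {⊥}) (fun _ h => Setoid.eq_bot_of_card_quotient h)
    (Set.toFinite _)).trans_eq (Set.ncard_singleton _)

theorem Setoid.sum_countClasses (X : Type*) [Finite X] [Nonempty X] :
    ∑ k ∈ Finset.Icc 1 (Nat.card X), Setoid.countClasses X k = Nat.bell (Nat.card X) := by
  classical
  have := Fintype.ofFinite (Setoid X)
  rw [← Setoid.natCard_eq_bell, Nat.card_eq_fintype_card (α := Setoid X), ← Finset.card_univ,
    Finset.card_eq_sum_card_fiberwise (t := Finset.Icc 1 (Nat.card X))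
      (f := fun s : Setoid X => Nat.card (Quotient s))]
  · refine Finset.sum_congr rfl fun k _ => ?_
    rw [Setoid.countClasses, ← Set.ncard_coe_finset]
    simp
  · intro s _
    simp only [Finset.coe_Icc, Set.mem_Icc]
    have : Nonempty (Quotient s) := ⟨Quotient.mk s (Classical.arbitrary X)⟩
    exact ⟨Nat.card_pos, Nat.card_le_card_of_surjective _ (Quotient.mk_surjective (s := s))⟩

namespace Difunctional

variable {X : Type*} {A : Set (Difunctional X)}

theorem countClasses_le_ncard_domSetoid [Finite X] (hA : Subsemigroup.closure A = ⊤) (k : ℕ) :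
    Setoid.countClasses X k ≤ {α ∈ A | LeftTotal α ∧ numClasses α = k}.ncard := by
  refine (Set.ncard_le_ncard (t := domSetoid '' {α ∈ A | LeftTotal α ∧ numClasses α = k})
    ?_ (Set.toFinite _)).trans (Set.ncard_image_le (Set.toFinite _))
  intro s hs
  obtain ⟨α, hα, h, rfl⟩ := exists_generator_domSetoid_eq hA s
  exact ⟨α, ⟨hα, h, hs⟩, rfl⟩

theorem countClasses_le_ncard_domSetoid_inverse [Finite X] (hA : Subsemigroup.closure A = ⊤)
    (k : ℕ) : Setoid.countClasses X k ≤
      {α ∈ A | LeftTotal (inverse α) ∧ numClasses (inverse α) = k}.ncard := by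
  refine (Set.ncard_le_ncard (t := (fun α => domSetoid (inverse α)) ''
    {α ∈ A | LeftTotal (inverse α) ∧ numClasses (inverse α) = k})
    ?_ (Set.toFinite _)).trans (Set.ncard_image_le (Set.toFinite _))
  intro s hs
  obtain ⟨α, hα, h, rfl⟩ := exists_generator_domSetoid_inverse_eq hA s
  exact ⟨α, ⟨hα, h, hs⟩, rfl⟩

theorem exists_leftTotal_not_rightTotal [Finite X] {k : ℕ} (h₁ : 1 ≤ k) (hk : k < Nat.card X) :
    ∃ α : Difunctional X, LeftTotal α ∧ numClasses α = k ∧ ¬ LeftTotal (inverse α) := by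
  obtain ⟨k, rfl⟩ := Nat.exists_eq_add_of_le' h₁
  have e := Finite.equivFin X
  obtain ⟨i₀⟩ : Nonempty (Fin (k + 1) ↪ X) :=
    ⟨(Fin.castLEEmb hk.le).trans e.symm.toEmbedding⟩
  obtain ⟨i₁⟩ : Nonempty (Option (Fin (k + 1)) ↪ X) :=
    ⟨((finSuccEquiv (k + 1)).symm.toEmbedding.trans (Fin.castLEEmb hk)).trans e.symm.toEmbedding⟩
  -- `f` is defined everywhere, while `g` also takes the value `none`; the strict inequality `hk`
  -- leaves a point for it.
  let f : X → Option (Fin (k + 1)) := fun x => some (Function.invFun i₀ x)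
  let g : X → Option (Fin (k + 1)) := Function.invFun i₁
  have hg₀ : Function.Surjective g := Function.invFun_surjective i₁.injective
  have hf : ∀ x, f x ≠ none := by simp [f]
  have hg : ∀ i, ∃ y, g y = some i := fun i => hg₀ _
  refine ⟨ofLabels f g, leftTotal_ofLabels hf hg, ?_, ?_⟩
  · rw [numClasses, domSetoid_ofLabels hf hg]
    have : Setoid.ker f = Setoid.ker (Function.invFun i₀) := by
      ext x y
      simp [Setoid.ker_def, f]
    rw [this, Nat.card_congr (Setoid.quotientKerEquivOfSurjective _
      (Function.invFun_surjective i₀.injective))]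
    simp
  · intro h
    obtain ⟨y, hy⟩ := hg₀ none
    obtain ⟨x, hx⟩ := h y
    exact hx.2 (hx.1.trans hy)

theorem _root_.Equiv.Perm.exists_not_commute (h : 3 ≤ Nat.card X) :
    ∃ π τ : Equiv.Perm X, π * τ ≠ τ * π := by
  classical
  have : Finite X := Nat.finite_of_card_ne_zero (by omega)
  have := Fintype.ofFinite X
  rw [Nat.card_eq_fintype_card] at h
  obtain ⟨a, b, c, hab, hac, hbc⟩ := Fintype.two_lt_card_iff.1 h
  refine ⟨Equiv.swap a b, Equiv.swap b c, fun h => ?_⟩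
  have := congrArg (fun π : Equiv.Perm X => π a) h
  simp [Equiv.Perm.mul_apply, Equiv.swap_apply_of_ne_of_ne hab hac] at this
  exact hbc this

theorem countClasses_lt_ncard_level [Finite X] (hX : 3 ≤ Nat.card X)
    (hA : Subsemigroup.closure A = ⊤) {k : ℕ} (hk : k ∈ Finset.Icc 1 (Nat.card X)) :
    Setoid.countClasses X k + 1 ≤ {α ∈ A | level α = k}.ncard := by
  by_contra! hlt
  have hlt := Nat.lt_succ_iff.1 hlt
  obtain ⟨hk₁, hk₂⟩ := Finset.mem_Icc.1 hk
  -- The left total generators already number at least S(n,k), so they exhaust the level; likewise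
  -- the right total ones.
  have hL : {α ∈ A | LeftTotal α ∧ numClasses α = k} = {α ∈ A | level α = k} := by
    refine Set.eq_of_subset_of_ncard_le ?_ (hlt.trans (countClasses_le_ncard_domSetoid hA k))
      (Set.toFinite _)
    rintro α ⟨hα, h, h'⟩
    exact ⟨hα, by rw [level, if_pos h, h']⟩
  have hR : {α ∈ A | LeftTotal (inverse α) ∧ numClasses (inverse α) = k} =
      {α ∈ A | level α = k} := by
    refine Set.eq_of_subset_of_ncard_le ?_
      (hlt.trans (countClasses_le_ncard_domSetoid_inverse hA k)) (Set.toFinite _)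
    rintro α ⟨hα, h, h'⟩
    refine ⟨hα, ?_⟩
    by_cases hl : LeftTotal α
    · rw [level, if_pos hl, ← h', numClasses_inverse hl h]
    · rw [level, if_neg hl, if_pos h, h']
  have key := mem_closure_of_leftTotal (A := A) (k := k) fun α hα h h' =>
    ((hL.trans hR.symm).subset ⟨hα, h, h'⟩).2.1
  simp only [hA, Subsemigroup.mem_top, forall_const] at key
  rcases hk₂.lt_or_eq with hk₂ | rfl
  · obtain ⟨α, h, h', h''⟩ := exists_leftTotal_not_rightTotal hk₁ hk₂
    exact h'' (key α h h').1
  · have : Nonempty (Difunctional X) := ⟨graph 1⟩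
    -- For k = n at most one generator is left, and a semigroup generated by one element is
    -- commutative.
    obtain ⟨a, ha⟩ := (Set.ncard_le_one_iff_subset_singleton (Set.toFinite _)).1
      (hL ▸ hlt.trans (Setoid.countClasses_card_le_one X))
    have hcomm : ∀ γ : Difunctional X, LeftTotal γ → numClasses γ = Nat.card X →
        γ ∈ Subsemigroup.closure {a} := fun γ h h' =>
      Subsemigroup.closure_mono ha (key γ h h').2
    obtain ⟨π, τ, hπ⟩ := Equiv.Perm.exists_not_commute hX
    refine hπ (graph_injective ?_)
    rw [← graph_mul_graph, ← graph_mul_graph]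
    have h₁ := hcomm _ (leftTotal_graph π) (numClasses_graph π)
    have h₂ := hcomm _ (leftTotal_graph τ) (numClasses_graph τ)
    have hc := Subsemigroup.closure_le_centralizer_centralizer {a} h₁
    have hc' : Subsemigroup.closure {a} ≤ Subsemigroup.centralizer {a} :=
      (Subsemigroup.closure_le).2 (by
        simp [Set.mem_centralizer_iff])
    exact Subsemigroup.mem_centralizer_iff.1 hc _ (hc' h₂)

theorem bell_add_card_le [Finite X] (hX : 3 ≤ Nat.card X) {A : Finset (Difunctional X)}
    (hA : Subsemigroup.closure (A : Set (Difunctional X)) = ⊤) :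
    Nat.bell (Nat.card X) + Nat.card X ≤ A.card := by
  classical
  have : Nonempty X := (Nat.card_pos_iff.1 (by omega)).1
  calc
    _ = ∑ k ∈ Finset.Icc 1 (Nat.card X), (Setoid.countClasses X k + 1) := by
      simp [Finset.sum_add_distrib, Setoid.sum_countClasses]
    _ ≤ ∑ k ∈ Finset.Icc 1 (Nat.card X), (A.filter fun α => level α = k).card := by
      refine Finset.sum_le_sum fun k hk => ?_
      rw [← Set.ncard_coe_finset, Finset.coe_filter]
      exact countClasses_lt_ncard_level hX hA hk
    _ ≤ A.card := by
      rw [Finset.sum_card_fiberwise_eq_card_filter]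
      exact Finset.card_filter_le _ _

end Difunctional

/-! ### Upper bound: products of permutations and of labelled relations. -/

theorem Equiv.Perm.exists_submonoid_closure_pair_eq_top {X : Type*} [Finite X]
    (h : 2 ≤ Nat.card X) : ∃ a b : Equiv.Perm X, Submonoid.closure {a, b} = ⊤ := by
  obtain ⟨n, hn⟩ := Nat.exists_eq_add_of_le' h
  have e : X ≃ Fin (n + 2) := Finite.equivFinOfCardEq hn
  have hF : Submonoid.closure {finRotate (n + 2), Equiv.swap 0 (finRotate (n + 2) 0)} = ⊤ := by
    rw [← Subgroup.closure_toSubmonoid_of_finite,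
      Equiv.Perm.closure_cycle_adjacent_swap isCycle_finRotate support_finRotate]
    rfl
  let φ : Equiv.Perm (Fin (n + 2)) ≃* Equiv.Perm X := e.symm.permCongrHom
  refine ⟨φ (finRotate (n + 2)), φ (Equiv.swap 0 (finRotate (n + 2) 0)), ?_⟩
  have := congrArg (Submonoid.map φ.toMonoidHom) hF
  rw [MonoidHom.map_mclosure, Set.image_pair] at this
  refine this.trans ?_
  rw [← MonoidHom.mrange_eq_map]
  exact MonoidHom.mrange_eq_top.2 φ.surjective

namespace Difunctional

variable {X : Type*}

theorem graph_mem_of_closure_eq_top [Finite X] {S : Subsemigroup (Difunctional X)}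
    {a b : Equiv.Perm X} (hab : Submonoid.closure {a, b} = ⊤) (ha : graph a ∈ S)
    (hb : graph b ∈ S) (π : Equiv.Perm X) : graph π ∈ S := by
  have hpow : ∀ k, graph (a ^ (k + 1)) ∈ S := by
    intro k
    induction k with
    | zero => simpa using ha
    | succ k ih =>
      rw [pow_succ, ← graph_mul_graph]
      exact mul_mem ha ih
  have hπ : π ∈ Submonoid.closure {a, b} := hab ▸ Submonoid.mem_top π
  induction hπ using Submonoid.closure_induction with
  | mem π h =>
    rcases h with rfl | rfl
    exacts [ha, hb]
  | one =>
    -- A subsemigroup need not contain 1, so the identity is obtained as a positive power of `a`.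
    have := hpow (orderOf a - 1)
    rwa [Nat.sub_add_cancel (orderOf_pos a), pow_orderOf_eq_one] at this
  | mul π τ _ _ hπ hτ =>
    rw [← graph_mul_graph]
    exact mul_mem hτ hπ

section Labels

variable {ι κ : Type*}

theorem ofLabels_mul_ofLabels (f g h : X → Option ι) (hg : ∀ i, ∃ x, g x = some i) :
    ofLabels f g * ofLabels g h = ofLabels f h := by
  refine ext_mem fun x y => ?_
  simp only [mem_mul, mem_ofLabels]
  constructor
  · rintro ⟨h₁, z, hz⟩
    have := (h₁ z).2 hz
    exact ⟨this.1.trans hz.1, this.2⟩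
  · rintro ⟨hxy, hx⟩
    obtain ⟨i, hi⟩ := Option.ne_none_iff_exists'.1 hx
    obtain ⟨z, hz⟩ := hg i
    refine ⟨fun w => ?_, z, ?_⟩
    · constructor
      · rintro ⟨h₁, h₂⟩
        exact ⟨h₁.symm.trans hxy, h₁ ▸ h₂⟩
      · rintro ⟨h₁, h₂⟩
        exact ⟨hxy.trans h₁.symm, hx⟩
    · simp [hz, ← hxy, hi]

theorem ofLabels_map {e : ι → κ} (he : Function.Injective e) (f g : X → Option ι) :
    ofLabels (fun x => (f x).map e) (fun x => (g x).map e) = ofLabels f g := by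
  refine ext_mem fun x y => ?_
  simp [mem_ofLabels, (Option.map_injective he).eq_iff]

theorem graph_mul_ofLabels (π : Equiv.Perm X) {f g : X → Option ι} (hf : Function.Injective f) :
    graph π * ofLabels f g = ofLabels (fun x => f (π x)) g := by
  refine ext_mem fun x y => ?_
  simp only [mem_mul, mem_ofLabels, mem_graph]
  constructor
  · rintro ⟨h, -⟩
    exact (h _).1 rfl
  · rintro ⟨h₁, h₂⟩
    refine ⟨fun z => ⟨?_, ?_⟩, π x, h₁, h₂⟩
    · rintro rfl
      exact ⟨h₁, h₂⟩
    · rintro ⟨h, -⟩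
      exact hf (h₁.trans h.symm)

theorem inverse_graph (π : Equiv.Perm X) : inverse (graph π) = graph π⁻¹ := by
  refine ext_mem fun x y => ?_
  rw [mem_inverse, mem_graph, mem_graph, Equiv.Perm.inv_eq_iff_eq, eq_comm]

theorem ofLabels_mul_graph (π : Equiv.Perm X) {f g : X → Option ι} (hg : Function.Injective g) :
    ofLabels f g * graph π⁻¹ = ofLabels f (fun x => g (π x)) := by
  have := congrArg inverse (graph_mul_ofLabels π (f := g) (g := f) hg)
  rwa [inverse_mul, inverse_ofLabels, inverse_ofLabels, inverse_graph] at this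

/-- A relation with few blocks whose domain and codomain are proper subsets of `X` is a product of
two relations having one more block. -/
theorem ofLabels_eq_mul (f g : X → Option ι) {h : X → Option (Option ι)}
    (hh : Function.Surjective h) [DecidableEq ι] :
    ofLabels (fun x => some (f x)) h *
      ofLabels (fun x => Equiv.swap none (some none) (h x)) (fun x => some (g x)) =
      ofLabels f g := by
  -- The label `none` of `f` is made a genuine block, matched with the fibre of `h` over `some
  -- none`; that of `g` is matched with the fibre over `none`. The fibres differ, so these blocks
  -- vanish in the product.
  refine ext_mem fun x y => ?_
  simp only [mem_mul, mem_ofLabels]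
  constructor
  · rintro ⟨h₁, -⟩
    obtain ⟨z, hz⟩ := hh (some (f x))
    have h₂ := (h₁ z).1 ⟨hz.symm, by simp⟩
    rw [hz] at h₂
    rcases hfx : f x with _ | i
    · simp [hfx] at h₂
    · rw [hfx, Equiv.swap_apply_of_ne_of_ne (by simp) (by simp)] at h₂
      exact ⟨Option.some.inj h₂.1, by simp⟩
  · rintro ⟨h₁, h₂⟩
    obtain ⟨i, hi⟩ := Option.ne_none_iff_exists'.1 h₂
    rw [← h₁, hi]
    have key : ∀ u : Option (Option ι), Equiv.swap none (some none) u = some (some i) ↔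
        u = some (some i) := by
      intro u
      rw [Equiv.swap_apply_eq_iff, Equiv.swap_apply_of_ne_of_ne (by simp) (by simp)]
    obtain ⟨z, hz⟩ := hh (some (some i))
    refine ⟨fun w => ?_, z, ?_⟩
    · constructor
      · rintro ⟨h₃, -⟩
        have := (key (h w)).2 h₃.symm
        exact ⟨this, by simp [this]⟩
      · rintro ⟨h₃, -⟩
        exact ⟨((key _).1 h₃).symm, by simp⟩
    · have := (key (h z)).2 hz
      exact ⟨this, by simp [this]⟩

end Labels

/-- The labels are the nonempty rows of `α`; by difunctionality all points of a column have the same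
row. -/
theorem exists_eq_ofLabels [Finite X] (α : Difunctional X) :
    ∃ (k : ℕ) (f g : X → Option (Fin k)), (∀ i, ∃ x, f x = some i) ∧
      (∀ i, ∃ x, g x = some i) ∧ α = ofLabels f g := by
  classical
  let B := {B : Set X // B.Nonempty ∧ ∃ x, B = {z | (x, z) ∈ α.1}}
  let f : X → Option B := fun x =>
    if h : {z | (x, z) ∈ α.1}.Nonempty then some ⟨_, h, x, rfl⟩ else none
  let g : X → Option B := fun y =>
    if h : ∃ x, (x, y) ∈ α.1 then some ⟨{z | (h.choose, z) ∈ α.1}, ⟨y, h.choose_spec⟩, _, rfl⟩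
    else none
  have hfg : ∀ x y, (x, y) ∈ α.1 → f x = g y := by
    intro x y hxy
    have h₁ : {z | (x, z) ∈ α.1}.Nonempty := ⟨y, hxy⟩
    have h₂ : ∃ x, (x, y) ∈ α.1 := ⟨x, hxy⟩
    simp only [f, g, dif_pos h₁, dif_pos h₂, Option.some.injEq]
    exact Subtype.ext (Set.ext (domSetoid_rel_of_mem hxy h₂.choose_spec))
  have hf : ∀ i, ∃ x y, (x, y) ∈ α.1 ∧ f x = some i := by
    rintro ⟨_, ⟨y, hy⟩, x, rfl⟩
    exact ⟨x, y, hy, dif_pos ⟨y, hy⟩⟩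
  have hα : α = ofLabels f g := by
    refine ext_mem fun x y => ⟨fun h => ⟨hfg x y h, ?_⟩, ?_⟩
    · have h₁ : {z | (x, z) ∈ α.1}.Nonempty := ⟨y, h⟩
      simp [f, dif_pos h₁]
    · rintro ⟨h₁, h₂⟩
      by_cases hx : {z | (x, z) ∈ α.1}.Nonempty
      · by_cases hy : ∃ x, (x, y) ∈ α.1
        · simp only [f, g, dif_pos hx, dif_pos hy, Option.some.injEq] at h₁
          exact (congrArg Subtype.val h₁).symm.subset hy.choose_spec
        · simp [f, g, dif_pos hx, dif_neg hy] at h₁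
      · simp [f, dif_neg hx] at h₂
  let e : B ≃ Fin (Nat.card B) := Finite.equivFin B
  refine ⟨Nat.card B, fun x => (f x).map e, fun x => (g x).map e, fun i => ?_, fun i => ?_, ?_⟩
  · obtain ⟨x, y, -, h⟩ := hf (e.symm i)
    exact ⟨x, by simp [h]⟩
  · obtain ⟨x, y, h, h'⟩ := hf (e.symm i)
    exact ⟨y, by simp [← hfg x y h, h']⟩
  · rw [ofLabels_map e.injective, ← hα]

end Difunctional

/-! ### Upper bound: descent through the ranks. -/

namespace Difunctional

variable {X : Type*}

/-- `S` contains all relations with `k` blocks. -/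
def ContainsRank (S : Subsemigroup (Difunctional X)) (k : ℕ) : Prop :=
  ∀ f g : X → Option (Fin k), (∀ i, ∃ x, f x = some i) → (∀ i, ∃ x, g x = some i) →
    ofLabels f g ∈ S

/-- `S` contains all relations with `k` blocks whose domain and codomain are proper subsets of
`X`. -/
def ContainsProperRank (S : Subsemigroup (Difunctional X)) (k : ℕ) : Prop :=
  ∀ f g : X → Option (Fin k), Function.Surjective f → Function.Surjective g → ofLabels f g ∈ S

theorem surjective_of_onto_of_none {ι : Type*} {f : X → Option ι} (hf : ∀ i, ∃ x, f x = some i)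
    (h : ∃ x, f x = none) : Function.Surjective f
  | none => h
  | some i => hf i

theorem containsProperRank_of_succ [Finite X] {S : Subsemigroup (Difunctional X)} {k : ℕ}
    (hk : k + 2 ≤ Nat.card X) (h : ContainsRank S (k + 1)) : ContainsProperRank S k := by
  intro f g hf hg
  have hS : ∀ f g : X → Option (Option (Fin k)), (∀ i, ∃ x, f x = some i) →
      (∀ i, ∃ x, g x = some i) → ofLabels f g ∈ S := by
    intro f g hf hg
    rw [← ofLabels_map (finSuccEquiv k).symm.injective]
    refine h _ _ (fun i => ?_) (fun i => ?_)
    · obtain ⟨x, hx⟩ := hf (finSuccEquiv k i)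
      exact ⟨x, by simp [hx]⟩
    · obtain ⟨x, hx⟩ := hg (finSuccEquiv k i)
      exact ⟨x, by simp [hx]⟩
  obtain ⟨i⟩ : Nonempty (Option (Option (Fin k)) ↪ X) := by
    have := Fintype.ofFinite X
    refine Function.Embedding.nonempty_of_card_le ?_
    rw [Nat.card_eq_fintype_card] at hk
    simpa using Nat.lt_of_succ_le hk
  have hs := Function.invFun_surjective i.injective
  rw [← ofLabels_eq_mul f g hs]
  refine mul_mem (hS _ _ (fun i => ?_) fun i => hs _) (hS _ _ (fun i => ?_) fun i => ?_)
  · obtain ⟨x, hx⟩ := hf i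
    exact ⟨x, by rw [hx]⟩
  · obtain ⟨x, hx⟩ := hs (Equiv.swap none (some none) (some i))
    exact ⟨x, by rw [hx, Equiv.swap_apply_self]⟩
  · obtain ⟨x, hx⟩ := hg i
    exact ⟨x, by rw [hx]⟩

/-- Covers k = n - 1, where there is no room for the extra block. A surjection onto `Option (Fin k)`
is then a bijection, so permutations carry one relation to all others. -/
theorem containsProperRank_of_graph [Finite X] {S : Subsemigroup (Difunctional X)} {k : ℕ}
    (hk : k + 1 = Nat.card X) (h : ∀ π : Equiv.Perm X, graph π ∈ S) {ν : X → Option (Fin k)}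
    (hν : Function.Surjective ν) (hνS : ofLabels ν ν ∈ S) : ContainsProperRank S k := by
  intro f g hf hg
  have hbij : ∀ {f : X → Option (Fin k)}, Function.Surjective f → Function.Bijective f :=
    fun hf => hf.bijective_of_nat_card_le (by simp [← hk])
  have key : ∀ {f : X → Option (Fin k)}, Function.Surjective f →
      ∃ π : Equiv.Perm X, (fun x => ν (π x)) = f := fun {f} hf =>
    ⟨(Equiv.ofBijective f (hbij hf)).trans (Equiv.ofBijective ν (hbij hν)).symm, by
      ext1 x
      exact (Equiv.ofBijective ν (hbij hν)).apply_symm_apply (f x)⟩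
  obtain ⟨π, rfl⟩ := key hf
  obtain ⟨τ, rfl⟩ := key hg
  rw [← graph_mul_ofLabels π (hbij hν).1, ← ofLabels_mul_graph τ (hbij hν).1]
  exact mul_mem (h _) (mul_mem hνS (h _))

theorem containsRank_card [Finite X] {S : Subsemigroup (Difunctional X)}
    (h : ∀ π : Equiv.Perm X, graph π ∈ S) : ContainsRank S (Nat.card X) := by
  intro f g hf hg
  have key : ∀ {f : X → Option (Fin (Nat.card X))}, (∀ i, ∃ x, f x = some i) →
      ∃ e : X ≃ Fin (Nat.card X), f = fun x => some (e x) := by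
    intro f hf
    choose s hs using hf
    have hinj : Function.Injective s := fun i j hij =>
      Option.some.inj ((hs i).symm.trans ((congrArg f hij).trans (hs j)))
    have hbij := hinj.bijective_of_nat_card_le (by simp)
    refine ⟨(Equiv.ofBijective s hbij).symm, ?_⟩
    ext1 x
    obtain ⟨i, rfl⟩ := hbij.2 x
    rw [hs, Equiv.ofBijective_symm_apply_apply]
  obtain ⟨e, rfl⟩ := key hf
  obtain ⟨e', rfl⟩ := key hg
  convert h (e.trans e'.symm)
  refine ext_mem fun x y => ?_
  simp [mem_ofLabels, mem_graph, Equiv.symm_apply_eq]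

/-- The generators are the edges of a closed path from `ν` through one labelling of each partition.
Sub-paths join any total labelling to a proper one in both directions. -/
theorem exists_generators [Finite X] {k : ℕ} (hk : k < Nat.card X) :
    ∃ B : Finset (Difunctional X), B.card ≤ Setoid.countClasses X k + 1 ∧
      ∀ S : Subsemigroup (Difunctional X), (B : Set (Difunctional X)) ⊆ S →
        (∃ ν : X → Option (Fin k), Function.Surjective ν ∧ ofLabels ν ν ∈ S) ∧
          (ContainsProperRank S k → ContainsRank S k) := by
  classical
  obtain ⟨ν, hν⟩ : ∃ ν : X → Option (Fin k), Function.Surjective ν := by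
    obtain ⟨i⟩ : Nonempty (Option (Fin k) ↪ X) := by
      have := Fintype.ofFinite X
      refine Function.Embedding.nonempty_of_card_le ?_
      rw [Nat.card_eq_fintype_card] at hk
      simpa using hk
    exact ⟨_, Function.invFun_surjective i.injective⟩
  let T := {s : Setoid X // Nat.card (Quotient s) = k}
  have hT : Nat.card T = Setoid.countClasses X k := rfl
  let t : T ≃ Fin (Setoid.countClasses X k) := Finite.equivFinOfCardEq hT
  let q : (s : T) → Quotient s.1 ≃ Fin k := fun s => Finite.equivFinOfCardEq s.2
  let label : T → X → Option (Fin k) := fun s x => some (q s (Quotient.mk s.1 x))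
  -- Position 0 and every position past the last partition hold `ν`, which closes the path.
  let e : ℕ → X → Option (Fin k)
    | 0 => ν
    | i + 1 => if h : i < Setoid.countClasses X k then label (t.symm ⟨i, h⟩) else ν
  have he : ∀ j i, ∃ x, e j x = some i := by
    have hl : ∀ s i, ∃ x, label s x = some i := by
      intro s i
      obtain ⟨x, hx⟩ := Quotient.exists_rep ((q s).symm i)
      exact ⟨x, by simp [label, hx]⟩
    rintro (_ | j) i
    · exact hν _
    · simp only [e]
      split_ifs
      exacts [hl _ i, hν _]
  refine ⟨(Finset.range (Setoid.countClasses X k + 1)).image fun i => ofLabels (e i) (e (i + 1)),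
    Finset.card_image_le.trans (by simp), fun S hS => ?_⟩
  have hstep : ∀ i < Setoid.countClasses X k + 1, ofLabels (e i) (e (i + 1)) ∈ S := fun i hi =>
    hS (Finset.mem_coe.2 (Finset.mem_image_of_mem _ (Finset.mem_range.2 hi)))
  have hpath : ∀ i j, i + 1 ≤ j → j ≤ Setoid.countClasses X k + 1 →
      ofLabels (e i) (e j) ∈ S := by
    intro i j hij
    induction j, hij using Nat.le_induction with
    | base => exact fun h => hstep i h
    | succ j hij ih =>
      intro hj
      rw [← ofLabels_mul_ofLabels _ (e j) _ (he j)]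
      exact mul_mem (ih (by omega)) (hstep j (by omega))
  have hlast : e (Setoid.countClasses X k + 1) = ν := dif_neg (lt_irrefl _)
  have hνS : ofLabels ν ν ∈ S := by
    have := hpath 0 (Setoid.countClasses X k + 1) (by omega) le_rfl
    rwa [hlast] at this
  refine ⟨⟨ν, hν, hνS⟩, fun hN => ?_⟩
  have key : ∀ f : X → Option (Fin k), (∀ i, ∃ x, f x = some i) →
      ∃ f' : X → Option (Fin k), Function.Surjective f' ∧ ofLabels f f' ∈ S ∧
        ofLabels f' f ∈ S := by
    intro f hf
    by_cases hfull : ∃ x, f x = none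
    · have hs := surjective_of_onto_of_none hf hfull
      exact ⟨f, hs, hN f f hs hs, hN f f hs hs⟩
    · push Not at hfull
      choose f' hf' using fun x => Option.ne_none_iff_exists'.1 (hfull x)
      have hs : Function.Surjective f' := by
        intro i
        obtain ⟨x, hx⟩ := hf i
        exact ⟨x, Option.some.inj ((hf' x).symm.trans hx)⟩
      let r : Quotient (Setoid.ker f') ≃ Fin k := Setoid.quotientKerEquivOfSurjective f' hs
      let s : T := ⟨Setoid.ker f', by rw [Nat.card_congr r, Nat.card_fin]⟩
      -- `σ` corrects the arbitrary numbering of the classes; relabelling both sides by it leaves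
      -- the relation unchanged.
      let σ : Equiv.Perm (Fin k) := (q s).symm.trans r
      have hσ : (fun x => (label s x).map σ) = f := by
        ext1 x
        simp only [label, σ, Option.map_some, Equiv.trans_apply, Equiv.symm_apply_apply, hf']
        rfl
      have hes : e (t s + 1) = label s := by
        simp only [e]
        rw [dif_pos (t s).2]
        simp
      have hlt := (t s).2
      refine ⟨fun x => (ν x).map σ, ?_, ?_, ?_⟩
      · exact (Equiv.optionCongr σ).surjective.comp hν
      · rw [← hσ, ofLabels_map σ.injective, ← hes, ← hlast]
        exact hpath (t s + 1) (Setoid.countClasses X k + 1) (by omega) le_rfl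
      · rw [← hσ, ofLabels_map σ.injective, ← hes]
        exact hpath 0 (t s + 1) (by omega) (by omega)
  intro f g hf hg
  obtain ⟨f', hf', h₁, -⟩ := key f hf
  obtain ⟨g', hg', -, h₂⟩ := key g hg
  rw [← ofLabels_mul_ofLabels f f' g fun i => hf' _,
    ← ofLabels_mul_ofLabels f' g' g fun i => hg' _]
  exact mul_mem h₁ (mul_mem (hN f' g' hf' hg') h₂)

theorem eq_top_of_containsRank [Finite X] {S : Subsemigroup (Difunctional X)}
    (h : ∀ k ≤ Nat.card X, ContainsRank S k) : S = ⊤ := by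
  rw [eq_top_iff]
  rintro α -
  obtain ⟨k, f, g, hf, hg, rfl⟩ := exists_eq_ofLabels α
  refine h k ?_ f g hf hg
  choose s hs using hf
  have hinj : Function.Injective s := fun i j hij =>
    Option.some.inj ((hs i).symm.trans ((congrArg f hij).trans (hs j)))
  simpa using Nat.card_le_card_of_injective s hinj

theorem exists_generating_finset [Finite X] (hX : 3 ≤ Nat.card X) :
    ∃ A : Finset (Difunctional X), Subsemigroup.closure (A : Set (Difunctional X)) = ⊤ ∧
      A.card ≤ Nat.bell (Nat.card X) + Nat.card X := by
  classical
  have : Nonempty X := (Nat.card_pos_iff.1 (by omega)).1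
  obtain ⟨n, hn⟩ := Nat.exists_eq_add_of_le' (show 1 ≤ Nat.card X by omega)
  obtain ⟨a, b, hab⟩ := Equiv.Perm.exists_submonoid_closure_pair_eq_top (X := X) (by omega)
  have hgen := fun k : ℕ => exists_generators (X := X) (k := k)
  choose! B hB hBS using hgen
  let A : Finset (Difunctional X) := {graph a, graph b} ∪ (Finset.Icc 1 n).biUnion B
  have hAS : (A : Set (Difunctional X)) ⊆ Subsemigroup.closure (A : Set (Difunctional X)) :=
    Subsemigroup.subset_closure
  have hgraph := graph_mem_of_closure_eq_top hab
    (hAS (by simp [A] : graph a ∈ (A : Set (Difunctional X)))) (hAS (by simp [A]))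
  have hgens : ∀ k ∈ Finset.Icc 1 n, (B k : Set (Difunctional X)) ⊆
      Subsemigroup.closure (A : Set (Difunctional X)) := fun k hk =>
    Set.Subset.trans (Finset.coe_subset.2
      ((Finset.subset_biUnion_of_mem B hk).trans Finset.subset_union_right)) hAS
  refine ⟨A, eq_top_of_containsRank fun k hk => ?_, ?_⟩
  · induction hk using Nat.decreasingInduction with
    | self => exact containsRank_card hgraph
    | of_succ k hk ih =>
      rcases Nat.eq_zero_or_pos k with rfl | hk₀
      -- Rank 0 needs no generator: the empty relation is a product of relations of rank 1.
      · intro f g _ _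
        have hs : ∀ f : X → Option (Fin 0), Function.Surjective f := fun f =>
          surjective_of_onto_of_none (fun i => i.elim0)
            ⟨Classical.arbitrary X, Subsingleton.elim _ _⟩
        exact containsProperRank_of_succ (by omega) ih f g (hs f) (hs g)
      · obtain ⟨⟨ν, hν, hνS⟩, h⟩ := hBS k hk _ (hgens k (Finset.mem_Icc.2 ⟨hk₀, by omega⟩))
        refine h ?_
        rcases Nat.lt_or_ge (k + 1) (Nat.card X) with hk₁ | hk₁
        · exact containsProperRank_of_succ hk₁ ih
        · exact containsProperRank_of_graph (by omega) hgraph hν hνS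
  -- The top summand is at least 2, which pays for the two permutations; here `n + 1` is the size of
  -- `X`.
  · have hpos : 1 ≤ Setoid.countClasses X (n + 1) := by
      rw [← hn, Setoid.countClasses, Nat.one_le_iff_ne_zero, ← Nat.pos_iff_ne_zero,
        Set.ncard_pos (Set.toFinite _)]
      refine ⟨domSetoid (graph 1), ?_⟩
      exact numClasses_graph 1
    calc
      A.card ≤ 2 + ∑ k ∈ Finset.Icc 1 n, (B k).card :=
        (Finset.card_union_le _ _).trans (Nat.add_le_add Finset.card_le_two Finset.card_biUnion_le)
      _ ≤ 2 + ∑ k ∈ Finset.Icc 1 n, (Setoid.countClasses X k + 1) := by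
        gcongr with k hk
        exact hB k (by have := Finset.mem_Icc.1 hk; omega)
      _ ≤ ∑ k ∈ Finset.Icc 1 (n + 1), (Setoid.countClasses X k + 1) := by
        rw [Finset.sum_Icc_succ_top (by omega)]
        omega
      _ = _ := by
        rw [← Setoid.sum_countClasses X, ← hn]
        simp [Finset.sum_add_distrib]

end Difunctional

theorem theorem2p3 {X : Type*} (n : ℕ) (hn : 3 ≤ n) (hX : Nat.card X = n) :
    IsLeast {k : ℕ | ∃ A : Finset (Difunctional X),
      Subsemigroup.closure (A : Set (Difunctional X)) = ⊤ ∧ A.card = k}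
      (Nat.bell n + n) := by
  subst hX
  have : Finite X := Nat.finite_of_card_ne_zero (by omega)
  constructor
  · obtain ⟨A, hA, hcard⟩ := Difunctional.exists_generating_finset hn
    exact ⟨A, hA, hcard.antisymm (Difunctional.bell_add_card_le hn hA)⟩
  · rintro k ⟨A, hA, rfl⟩
    exact Difunctional.bell_add_card_le hn hA
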